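/- **Webs and their strings.** A *web* is an irreducible $A_2$-web: a bipartite plane graph without multiple edges, with a fixed black/white colouring, embedded in a disk, in which boundary vertices have degree $1$, interior vertices have degree $3$, and every internal face has at least $6$ sides. Let $D$ be a web with $k\ge 1$ boundary vertices, numbered clockwise from a chosen leftmost vertex $v=v_1$. The *signature and state string* of $D$ is the dominant string $((j_1,s_1),\dots,(j_k,s_k))$, where $s_i\in\{\bullet,\circ\}$ is the colour of $v_i$ and $j_i\in\{1,0,\bar 1\}$, from which the Khovanov–Kuperberg growth rules build $D$: put $v_1,\dots,v_k$ on a line from left to right, each with a hanging strand labelled $j_i$, and repeatedly replace two adjacent strands (a strand is written as its label and the colour of its upper vertex) by * a fork: $1^\bullet 0^\bullet\to\bar1^\circ$, $0^\bullet\bar1^\bullet\to1^\circ$, $1^\bullet\bar1^\bullet\to0^\circ$, $\bar1^\circ0^\circ\to1^\bullet$, $0^\circ1^\circ\to\bar1^\bullet$, $\bar1^\circ1^\circ\to0^\bullet$; * an H: $1^\bullet0^\circ\to0^\circ1^\bullet$, $0^\bullet0^\circ\to1^\circ1^\bullet$, $0^\bullet1^\circ\to1^\circ0^\bullet$, $\bar1^\circ0^\bullet\to0^\bullet\bar1^\circ$,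 $0^\circ0^\bullet\to\bar1^\bullet\bar1^\circ$, $0^\circ\bar1^\bullet\to\bar1^\bullet0^\circ$; * an arc: $1^\bullet1^\circ\to\varnothing$, $\bar1^\circ\bar1^\bullet\to\varnothing$, until no strand is left. *Dominant* means that the lattice path whose $i$-th step is $\pm$ the weight of $j_i$ ($+$ for $\bullet$, $-$ for $\circ$) stays in the dominant Weyl chamber of $\mathfrak{sl}_3$ and returns to the origin. **Tableaux.** The tableau *coming from* $D$ is the sequence $T=(\lambda^0,\dots,\lambda^k)$ in $\mathbb Z^3$ with $\lambda^0=(0,0,0)$ in which $\lambda^i$ is obtained from $\lambda^{i-1}$ by adding $1$ (if $s_i=\bullet$) or $-1$ (if $s_i=\circ$) to the first, second or third part according to $j_i=1,0,\bar1$. All $\lambda^i$ are weakly decreasing. The entry $i$ is written, unprimed or primed ($i'$) respectively, in the box that is added to or removed from $\lambda^{i-1}$; rows are numbered from top to bottom, and boxes of negative parts lie to the left of the axis. **Jeu de taquin step of generalized oscillating promotion.** Replace the entry $1$ (resp. $1'$) by $\bullet$ (resp. $\bullet'$). Then for $i=2,\dots,k$ in order, with $b$ the box of the bullet, $r_b$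 its row and $c_b$ its column: * bullet unprimed: if $i$ is unprimed and directly below or directly right of $b$, swap $i$ and $\bullet$; if $i'$ is in $b$, move both $i'$ and $\bullet$ to column $c_b-1$ of the bottommost row of $\lambda^i$ of size $\lambda^i_{r_b}$; otherwise do nothing; * bullet primed: if $i'$ is primed and directly above or directly left of $b$, swap $i'$ and $\bullet'$; if the unprimed $i$ is in $b$, move both $i$ and $\bullet'$ to column $c_b+1$ of the topmost row of $\lambda^i$ of size $\lambda^i_{r_b}$; otherwise do nothing. **Corollary.** Let $T=(\lambda^0,\dots,\lambda^k)$ come from a web $D$ with leftmost vertex $v$, and suppose that no component of $D$ is the identity web (a single edge joining two boundary vertices). 1. If $v$ is black, let $\lambda^a$ be the first partition with $a>0$ and $\lambda^a_1=\lambda^a_2$, and $\lambda^b$ the first partition with $b>a$ and $\lambda^b_2=\lambda^b_3$. Both exist, and for $2\le i\le k$ the entry $i$ (or $i'$) changes row during the jeu de taquin step if and only if $i\in\{a,b\}$. 2. If $v$ is white, let $\lambda^a$ be the first partition with $a>0$ and $\lambda^a_2=\lambda^a_3$, and $\lambda^b$ the first partition with $b>a$ and $\lambda^b_1=\lambda^b_2$.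 Both exist, and for $2\le i\le k$ the entry $i$ (or $i'$) changes row during the jeu de taquin step if and only if $i\in\{a,b\}$. 3. An entry that changes row moves up one row (from row $r$ to row $r-1$) if it is unprimed, and down one row (from row $r$ to row $r+1$) if it is primed. -/

import Mathlib

/-- Colours of the vertices of a web. -/
inductive WebColor
  | black
  | white
  deriving DecidableEq

/-- The states `1`, `0`, `-1`. -/
inductive WebState
  | one
  | zero
  | negOne
  deriving DecidableEq

/-- Irreducible `A₂`-webs with `k` boundary vertices and a chosen leftmost vertex (number `0`), up to
homeomorphism, as planar combinatorial maps. A dart is a half-edge, based at one vertex. The boundary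
vertices are numbered clockwise and `bdry i` is the unique dart based at the `i`-th one.

The permutation `rot` turns each dart based at an interior vertex to the next dart counterclockwise
around that vertex. On the boundary darts it is the cyclic shift: this is the rotation around the
point obtained by collapsing the boundary circle of the disk, so that `rot` and `opp` describe a graph
drawn on the sphere, whose faces are the faces of the web in the disk. -/
structure Web (k : ℕ) where
  Dart : Type
  [fintypeDart : Fintype Dart]
  /-- The other half of the same edge. -/
  opp : Equiv.Perm Dart
  opp_opp : ∀ d, opp (opp d) = d
  opp_ne : ∀ d, opp d ≠ d
  rot : Equiv.Perm Dart
  bdry : Fin k → Dart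
  bdry_injective : Function.Injective bdry
  rot_bdry : ∀ i, rot (bdry i) = bdry (finRotate k i)
  /-- Interior vertices have degree three. -/
  rot_interior : ∀ d, d ∉ Set.range bdry → rot d ≠ d ∧ rot (rot (rot d)) = d
  /-- The colour of the vertex at which a dart is based. -/
  color : Dart → WebColor
  color_rot : ∀ d, d ∉ Set.range bdry → color (rot d) = color d
  /-- The colouring is proper. -/
  color_opp : ∀ d, color (opp d) ≠ color d
  /-- There are no multiple edges. -/
  no_multiple_edges : ∀ d e,
    (d = e ∨ (d ∉ Set.range bdry ∧ rot.SameCycle d e)) →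
    (opp d = opp e ∨ (opp d ∉ Set.range bdry ∧ rot.SameCycle (opp d) (opp e))) → d = e
  /-- Planarity, as Euler's formula `2 V + 2 F = 2 E + 4 C` on the sphere: the faces are the cycles of
  `rot * opp` and `C` is the number of connected components. -/
  planar :
    2 * Nat.card (Quotient (Equiv.Perm.SameCycle.setoid rot))
        + 2 * Nat.card (Quotient (Equiv.Perm.SameCycle.setoid (rot * opp)))
      = Nat.card Dart
        + 4 * Nat.card (MulAction.orbitRel.Quotient (Subgroup.closure {rot, opp}) Dart)
  /-- Internal faces (those that do not touch the boundary) have at least six sides. -/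
  nonelliptic : ∀ d, (∀ i, ¬ (rot * opp).SameCycle d (bdry i)) →
    6 ≤ Function.minimalPeriod (rot * opp) d

namespace Web

/-- `D` contains the identity web as a component: some edge joins two boundary vertices. -/
def ContainsIdentity {k : ℕ} (D : Web k) : Prop :=
  ∃ i j, D.opp (D.bdry i) = D.bdry j

/-- Labels in the `Y`-shaped growth rules: two adjacent strands hanging from vertices of colour `c`,
labelled `a`, `b` from left to right, merge into one strand labelled `x`. -/
inductive YRule : (c : WebColor) → (a b x : WebState) → Prop
  | b1 : YRule .black .one .zero .negOne
  | b2 : YRule .black .zero .negOne .one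
  | b3 : YRule .black .one .negOne .zero
  | w1 : YRule .white .negOne .zero .one
  | w2 : YRule .white .zero .one .negOne
  | w3 : YRule .white .negOne .one .zero

/-- Labels in the `H`-shaped growth rules: adjacent strands labelled `a`, `b`, the left one hanging
from a vertex of colour `c` and the right one from a vertex of the other colour, are joined by a
horizontal edge and continue as strands labelled `x`, `y`. -/
inductive HRule : (c : WebColor) → (a b x y : WebState) → Prop
  | b1 : HRule .black .one .zero .zero .one
  | b2 : HRule .black .zero .zero .one .one
  | b3 : HRule .black .zero .one .one .zero
  | w1 : HRule .white .negOne .zero .zero .negOne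
  | w2 : HRule .white .zero .zero .negOne .negOne
  | w3 : HRule .white .zero .negOne .negOne .zero

/-- Labels in the arc rules: adjacent strands, both labelled `a`, the left one hanging from a vertex
of colour `c` and the right one from a vertex of the other colour, are joined. -/
inductive ArcRule : (c : WebColor) → (a : WebState) → Prop
  | b : ArcRule .black .one
  | w : ArcRule .white .negOne

/-- One step of the growth algorithm, as it draws the web `D`. The boundary vertices lie on a
horizontal line and the web grows downwards; the list holds, from left to right, the hanging strands:
a strand is the dart of `D` at its upper end, with the label of the edge. The vertices that a step
creates are interior vertices of `D`, with the cyclic order of the edges as in the drawing. -/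
inductive GrowthStep {k : ℕ} (D : Web k) :
    List (D.Dart × WebState) → List (D.Dart × WebState) → Prop
  | arc (L R : List (D.Dart × WebState)) (d e : D.Dart) (a : WebState)
      (hrule : ArcRule (D.color d) a) (hde : D.opp d = e) :
      GrowthStep D (L ++ (d, a) :: (e, a) :: R) (L ++ R)
  | fork (L R : List (D.Dart × WebState)) (d e : D.Dart) (a b x : WebState)
      (hrule : YRule (D.color d) a b x)
      (hd : D.opp d ∉ Set.range D.bdry)
      (hde : D.rot (D.opp e) = D.opp d) :
      GrowthStep D (L ++ (d, a) :: (e, b) :: R) (L ++ (D.rot (D.opp d), x) :: R)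
  | bridge (L R : List (D.Dart × WebState)) (d e : D.Dart) (a b x y : WebState)
      (hrule : HRule (D.color d) a b x y)
      (hd : D.opp d ∉ Set.range D.bdry) (he : D.opp e ∉ Set.range D.bdry)
      (hde : D.opp (D.rot (D.rot (D.opp d))) = D.rot (D.opp e)) :
      GrowthStep D (L ++ (d, a) :: (e, b) :: R)
        (L ++ (D.rot (D.opp d), x) :: (D.rot (D.rot (D.opp e)), y) :: R)

/-- The weight of a state and colour in the weight lattice of `sl(3)`, in the basis formed by the
weights of `(1, black)` and `(-1, white)`, which span the dominant chamber. -/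
def weight : WebState → WebColor → ℤ × ℤ
  | .one, .black => (1, 0)
  | .zero, .black => (-1, 1)
  | .negOne, .black => (0, -1)
  | .one, .white => (-1, 0)
  | .zero, .white => (1, -1)
  | .negOne, .white => (0, 1)

/-- A signature and state string is dominant if its lattice path stays in the dominant chamber and
ends at the origin. -/
def Dominant {k : ℕ} (s : Fin k → WebColor) (j : Fin k → WebState) : Prop :=
  (∀ m : ℕ, m ≤ k → 0 ≤ ∑ i : Fin k with i.val < m, weight (j i) (s i)) ∧
    ∑ i : Fin k, weight (j i) (s i) = 0

/-- The signature of `D`: the colours of its boundary vertices, from the leftmost one clockwise. -/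
def signature {k : ℕ} (D : Web k) : Fin k → WebColor := fun i => D.color (D.bdry i)

/-- `j`, together with the signature of `D`, is the signature and state string of `D`: it is dominant
and the growth algorithm applied to it draws `D`. (A complete run of the algorithm inside `D` reaches
all of `D`, and reaches each dart once.) -/
def IsStateString {k : ℕ} (D : Web k) (j : Fin k → WebState) : Prop :=
  Dominant D.signature j ∧
    Relation.ReflTransGen D.GrowthStep (List.ofFn fun i => (D.bdry i, j i)) []

end Web

/-- Generalized oscillating tableaux of length `k` with `n` parts. Rows are numbered from the top,
starting with `0`. The entry `i : Fin k` stands for the entry `i + 1` of the filling, which records the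
step from `part i.castSucc` to `part i.succ`; it is primed if this step removes a box. The fields `row`
and `primed` are determined by `part`. -/
structure GOT (k n : ℕ) where
  part : Fin (k + 1) → Fin n → ℤ
  part_zero : part 0 = 0
  part_antitone : ∀ i, Antitone (part i)
  row : Fin k → Fin n
  primed : Fin k → Bool
  part_succ : ∀ i, part i.succ =
    part i.castSucc + Pi.single (row i) (if primed i then (-1 : ℤ) else 1)

/-- The row of a generalized partition into which a state adds (or from which it removes) a box. -/
def WebState.row : WebState → Fin 3
  | .one => 0
  | .zero => 1
  | .negOne => 2

namespace GOT

variable {k n : ℕ}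

/-- `T` is the tableau of the web `D` with its chosen leftmost vertex: it is read off from the
signature and state string of `D`, black adding and white removing boxes. -/
def ComesFrom (T : GOT k 3) (D : Web k) : Prop :=
  ∃ j : Fin k → WebState, D.IsStateString j ∧
    ∀ i, T.row i = (j i).row ∧ (T.primed i = true ↔ D.signature i = .white)

/-- The box `(r, c)` that holds an entry in the filling of `T`. Here `r` is the row, and the column is
`c` if a part of size `c` has this box as its end and a part of size `c - 1` does not; thus the columns
`1, 2, …` are the positive ones and `0, -1, …` are the negative ones, from right to left. -/
def box (T : GOT k n) (i : Fin k) : Fin n × ℤ :=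
  (T.row i, if T.primed i then T.part i.castSucc (T.row i) else T.part i.succ (T.row i))

/-- The filling during promotion: the boxes of the entries and of the bullet. -/
structure Filling (k n : ℕ) where
  entry : Fin k → Fin n × ℤ
  bullet : Fin n × ℤ

/-- The bottommost row of `p` that has the same size as row `r`. -/
def bottomRow (p : Fin n → ℤ) (r : Fin n) : Fin n :=
  (Finset.univ.filter fun s => p s = p r).max' ⟨r, by simp⟩

/-- The topmost row of `p` that has the same size as row `r`. -/
def topRow (p : Fin n → ℤ) (r : Fin n) : Fin n :=
  (Finset.univ.filter fun s => p s = p r).min' ⟨r, by simp⟩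

/-- The jeu de taquin move for the entry `i`. The bullet is primed if the first entry of `T` is. Where
the bullet shares its box with `i`, both move by one column, to the extreme row of the same size in the
partition after step `i`, which is the present row if the next row has a different size. -/
def slide [NeZero k] (T : GOT k n) (i : Fin k) (F : Filling k n) : Filling k n :=
  let b := F.bullet
  let e := F.entry i
  if T.primed 0 = false then
    if T.primed i = false ∧
        ((e.1.val = b.1.val + 1 ∧ e.2 = b.2) ∨ (e.1 = b.1 ∧ e.2 = b.2 + 1)) then
      { entry := Function.update F.entry i b, bullet := e }
    else if T.primed i = true ∧ e = b then
      let b' := (bottomRow (T.part i.succ) b.1, b.2 - 1)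
      { entry := Function.update F.entry i b', bullet := b' }
    else F
  else
    if T.primed i = true ∧
        ((e.1.val + 1 = b.1.val ∧ e.2 = b.2) ∨ (e.1 = b.1 ∧ e.2 = b.2 - 1)) then
      { entry := Function.update F.entry i b, bullet := e }
    else if T.primed i = false ∧ e = b then
      let b' := (topRow (T.part i.succ) b.1, b.2 + 1)
      { entry := Function.update F.entry i b', bullet := b' }
    else F

/-- The first step of promotion: the bullet replaces the first entry. (The value of `entry` at the deleted
first entry plays no role.) -/
def startFilling [NeZero k] (T : GOT k n) : Filling k n where
  entry := T.box
  bullet := T.box 0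

/-- The filling after the jeu de taquin step of promotion: all entries but the first slide, in increasing order. -/
def slideAll [NeZero k] (T : GOT k n) : Filling k n :=
  (List.finRange k).tail.foldl (fun F i => T.slide i F) T.startFilling

/-- The row of an entry at the end of the jeu de taquin step of promotion. -/
def newRow [NeZero k] (T : GOT k n) (i : Fin k) : Fin n := (T.slideAll.entry i).1

/-- The entry `i` changes row during the jeu de taquin step of promotion. -/
def ChangesRow [NeZero k] (T : GOT k n) (i : Fin k) : Prop := T.newRow i ≠ T.row i

/-- `a` and `b` are the indices of the first partition after the initial empty one whose rows `p` and
`p + 1` have equal size, and of the first later one whose rows `q` and `q + 1` have equal size. -/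
def FirstEqualities (T : GOT k 3) (p q : Fin 2) (a b : Fin (k + 1)) : Prop :=
  IsLeast {i | 0 < i ∧ T.part i p.castSucc = T.part i p.succ} a ∧
    IsLeast {i | a < i ∧ T.part i q.castSucc = T.part i q.succ} b

end GOT

/-! The differences of consecutive parts turn `T` into a lattice path in the dominant chamber of
`sl(3)`, and equality of two adjacent rows means that the path is on a wall. Suppose the first
vertex is black. The bullet then always sits at the end of a row that is strictly longer than every
lower row: row `0` before `a`, row `1` from `a` until `b`, row `2` afterwards. A single move keeps
the bullet in its row unless the current step makes that row tie with the next one. In that case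
either an unprimed entry was added directly below the bullet and trades places with it, or a primed
entry shares the bullet's box and drops with it to the tied row. So the rows change exactly at the
ties, and the direction is visible from the move (`slide_unprimed`, `movesIff_newRow`). A white
first vertex gives the mirror image, with the bullet one column past the end of a row shorter than
all higher ones.

The argument needs the path to be away from the origin at time `a`; otherwise all three rows tie at
once. This is where the web enters. Up to `a` the path stays in the chamber translated by its first
step. If it were at the origin at `a`, the first strand and the strand of step `a` would have
opposite weights and enclose a closed dominant path. Every growth step preserves this configuration
until the two strands are joined by an arc (`GrowthStep.enclosing`), and a run that ends with no
strands must reach that arc. The first vertex would then lie on an identity component, which is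
excluded. -/

/-! ### Growth steps and the lattice path of the hanging strands -/

namespace Web

variable {k : ℕ} (D : Web k)

/-- The weight of a strand. -/
def strandWeight (x : D.Dart × WebState) : ℤ × ℤ := weight x.2 (D.color x.1)

/-- The lattice path of a list of strands, started at `p`, stays in the dominant chamber and ends
at `q`. -/
def DominantPath : ℤ × ℤ → List (D.Dart × WebState) → ℤ × ℤ → Prop
  | p, [], q => p = q
  | p, x :: L, q => 0 ≤ p + D.strandWeight x ∧ DominantPath (p + D.strandWeight x) L q

variable {D}

theorem dominantPath_append {L M : List (D.Dart × WebState)} {p q : ℤ × ℤ} :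
    D.DominantPath p (L ++ M) q ↔ ∃ r, D.DominantPath p L r ∧ D.DominantPath r M q := by
  induction L generalizing p with
  | nil => simp [DominantPath]
  | cons x L ih => simp [DominantPath, ih, and_assoc]

theorem DominantPath.nonneg {L : List (D.Dart × WebState)} {p q : ℤ × ℤ} (hp : 0 ≤ p)
    (h : D.DominantPath p L q) : 0 ≤ q := by
  induction L generalizing p with
  | nil => exact h ▸ hp
  | cons x L ih => exact ih h.1 h.2

theorem color_eq_of_ne_of_ne {a b c : WebColor} (h₁ : a ≠ c) (h₂ : b ≠ c) : a = b := by
  cases a <;> cases b <;> cases c <;> simp_all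

theorem rot_notMem_range {d : D.Dart} (hd : d ∉ Set.range D.bdry) :
    D.rot d ∉ Set.range D.bdry := by
  rintro ⟨i, hi⟩
  refine hd ⟨(finRotate k).symm i, D.rot.injective ?_⟩
  rw [D.rot_bdry, Equiv.apply_symm_apply, hi]

theorem notMem_range_of_rot {d : D.Dart} (hd : D.rot d ∉ Set.range D.bdry) :
    d ∉ Set.range D.bdry := by
  rintro ⟨i, rfl⟩
  exact hd ⟨_, (D.rot_bdry i).symm⟩

/-- A growth step replaces two adjacent strands, the left one not of antidominant and the right one
not of dominant weight, in a way that keeps the lattice path dominant; if it acts on a dominant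
strand and one of opposite weight, then it joins them by an arc. -/
theorem GrowthStep.exists_local {l l' : List (D.Dart × WebState)} (h : D.GrowthStep l l') :
    ∃ L R x y Z, l = L ++ x :: y :: R ∧ l' = L ++ (Z ++ R) ∧
      ¬ D.strandWeight x ≤ 0 ∧ ¬ 0 ≤ D.strandWeight y ∧
      (0 ≤ D.strandWeight x → D.strandWeight y = -D.strandWeight x → D.opp x.1 = y.1) ∧
      ∀ p q, 0 ≤ p → D.DominantPath p [x, y] q → D.DominantPath p Z q := by
  cases h with
  | arc L R d e a hrule hde =>
    have hc := D.color_opp d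
    rw [hde] at hc
    refine ⟨L, R, _, _, [], rfl, rfl, ?_⟩
    simp only [strandWeight, DominantPath]
    generalize D.color d = c at *
    generalize D.color e = c' at *
    cases hrule <;> cases c' <;> simp_all [weight, Prod.le_def, Prod.ext_iff]
  | fork L R d e a b x hrule hd hde =>
    have he : D.opp e ∉ Set.range D.bdry := notMem_range_of_rot (hde ▸ hd)
    have hx : D.color (D.rot (D.opp d)) ≠ D.color d := by
      rw [D.color_rot _ hd]; exact D.color_opp d
    have hc : D.color e = D.color d := by
      refine color_eq_of_ne_of_ne (D.color_opp e).symm ?_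
      rw [← D.color_rot _ he, hde]; exact (D.color_opp d).symm
    refine ⟨L, R, _, _, [_], rfl, rfl, ?_⟩
    simp only [strandWeight, DominantPath, hc]
    generalize D.color d = c at *
    generalize D.color (D.rot (D.opp d)) = c' at *
    cases hrule <;> cases c' <;> simp_all [weight, Prod.le_def, Prod.ext_iff] <;> omega
  | bridge L R d e a b x y hrule hd he hde =>
    have hx : D.color (D.rot (D.opp d)) ≠ D.color d := by
      rw [D.color_rot _ hd]; exact D.color_opp d
    have hy : D.color (D.rot (D.rot (D.opp e))) ≠ D.color e := by
      rw [D.color_rot _ (rot_notMem_range he), D.color_rot _ he]; exact D.color_opp e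
    -- The two ends of the rung have opposite colours, hence so do the vertices above them; each
    -- outgoing strand thus has the colour of the opposite incoming one.
    have hc : D.color e ≠ D.color d := by
      have h := D.color_opp (D.rot (D.rot (D.opp d)))
      rw [hde, D.color_rot _ (rot_notMem_range hd), D.color_rot _ he, D.color_rot _ hd] at h
      exact fun hed => h (color_eq_of_ne_of_ne (hed ▸ D.color_opp e) (D.color_opp d))
    have hx' := color_eq_of_ne_of_ne hx hc
    have hy' := color_eq_of_ne_of_ne hy hc.symm
    refine ⟨L, R, _, _, [_, _], rfl, rfl, ?_⟩
    simp only [strandWeight, DominantPath, hx', hy']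
    clear hx' hy' hx hy hd he hde
    generalize D.color d = c at *
    generalize D.color e = c' at *
    refine ⟨?_, ?_, ?_, ?_⟩
    · cases hrule <;> simp [weight, Prod.le_def]
    · cases hrule <;> cases c' <;> simp [weight, Prod.le_def] at hc ⊢
    · cases hrule <;> cases c' <;> simp [weight, Prod.le_def] at hc ⊢
    · rintro ⟨p₁, p₂⟩ ⟨q₁, q₂⟩
      cases hrule <;> cases c' <;> simp only [ne_eq, not_true_eq_false, reduceCtorEq] at hc <;>
        simp only [weight, Prod.le_def, Prod.mk_add_mk, Prod.mk.injEq, Prod.fst_zero,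
          Prod.snd_zero] <;> omega

/-- Two strands of opposite weights, the left one dominant, that enclose a closed dominant path keep
doing so until they are joined by an arc. -/
theorem GrowthStep.enclosing {l l' : List (D.Dart × WebState)} (h : D.GrowthStep l l')
    {u v : D.Dart × WebState} (hu : 0 ≤ D.strandWeight u)
    (hv : D.strandWeight v = -D.strandWeight u)
    (hl : ∃ X R, l = u :: (X ++ v :: R) ∧ D.DominantPath 0 X 0) :
    (∃ X R, l' = u :: (X ++ v :: R) ∧ D.DominantPath 0 X 0) ∨ D.opp u.1 = v.1 := by
  obtain ⟨X, S, hl, hX⟩ := hl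
  obtain ⟨L, R, x, y, Z, rfl, rfl, hx, hy, harc, hZ⟩ := h.exists_local
  have hv0 : D.strandWeight v ≤ 0 := by rw [hv]; exact neg_nonpos.2 hu
  rcases L with _ | ⟨u', L⟩
  · rw [List.nil_append, List.cons.injEq] at hl
    obtain ⟨rfl, hl⟩ := hl
    rcases X with _ | ⟨y', X⟩
    · rw [List.nil_append, List.cons.injEq] at hl
      obtain ⟨rfl, -⟩ := hl
      -- Nothing is left between the two strands and the step acts on exactly this pair.
      exact .inr (harc hu hv)
    · rw [List.cons_append, List.cons.injEq] at hl
      obtain ⟨rfl, -⟩ := hl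
      -- The first step of a dominant path from the origin has dominant weight, so it cannot be a
      -- right partner.
      exact absurd (by simpa using hX.1) hy
  · rw [List.cons_append, List.cons.injEq] at hl
    obtain ⟨rfl, hl⟩ := hl
    left
    -- The pair starts inside `X`, or at or after `v`. Only pairs entirely inside `X` or entirely to
    -- the right of `v` survive.
    rcases List.append_eq_append_iff.1 hl with ⟨A, rfl, hA⟩ | ⟨C, rfl, hC⟩
    · rcases A with _ | ⟨x', _ | ⟨y', A⟩⟩
      · rw [List.nil_append, List.cons.injEq] at hA
        exact absurd (hA.1 ▸ hv0) hx
      · simp only [List.cons_append, List.nil_append, List.cons.injEq] at hA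
        obtain ⟨rfl, rfl, -⟩ := hA
        obtain ⟨r, hr, hr'⟩ := dominantPath_append.1 hX
        have h0 : r + D.strandWeight x = 0 := hr'.2
        -- The last step of a dominant path ending at the origin has antidominant weight, so it
        -- cannot be a left partner.
        refine absurd ?_ hx
        rw [eq_neg_of_add_eq_zero_right h0]
        exact neg_nonpos.2 (hr.nonneg le_rfl)
      · simp only [List.cons_append, List.cons.injEq] at hA
        obtain ⟨rfl, rfl, rfl⟩ := hA
        refine ⟨L ++ (Z ++ A), S, by simp, ?_⟩
        obtain ⟨r, hr, hr'⟩ := dominantPath_append.1 hX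
        obtain ⟨t, ht, ht'⟩ := (dominantPath_append (L := [x, y])).1 hr'
        exact dominantPath_append.2
          ⟨r, hr, dominantPath_append.2 ⟨t, hZ _ _ (hr.nonneg le_rfl) ht, ht'⟩⟩
    · rcases C with _ | ⟨v', C⟩
      · rw [List.nil_append, List.cons.injEq] at hC
        exact absurd (hC.1 ▸ hv0) hx
      · rw [List.cons_append, List.cons.injEq] at hC
        obtain ⟨rfl, rfl⟩ := hC
        exact ⟨X, C ++ (Z ++ R), by simp, hX⟩

/-- The empty list contains no enclosing pair, so somewhere along the run the configuration must
end, and an arc is the only way. -/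
theorem opp_eq_of_enclosing {l : List (D.Dart × WebState)}
    (h : Relation.ReflTransGen D.GrowthStep l [])
    {u v : D.Dart × WebState} (hu : 0 ≤ D.strandWeight u)
    (hv : D.strandWeight v = -D.strandWeight u)
    (hl : ∃ X R, l = u :: (X ++ v :: R) ∧ D.DominantPath 0 X 0) : D.opp u.1 = v.1 := by
  induction h using Relation.ReflTransGen.head_induction_on with
  | refl => simp at hl
  | head hstep _ ih => exact (hstep.enclosing hu hv hl).elim ih id

/-- If the lattice path of the state string first returns to the origin at step `n`, without having
left the translate of the chamber by its first step, then the first boundary vertex is joined to the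
vertex of that step. -/
theorem opp_bdry_zero_of_path [NeZero k] {j : Fin k → WebState}
    (hrun : Relation.ReflTransGen D.GrowthStep (List.ofFn fun i => (D.bdry i, j i)) [])
    (P : Fin (k + 1) → ℤ × ℤ) (hP0 : P 0 = 0)
    (hP : ∀ i : Fin k, P i.succ = P i.castSucc + D.strandWeight (D.bdry i, j i))
    (h0 : 0 ≤ D.strandWeight (D.bdry 0, j 0)) {n : Fin k}
    (hn : P n.succ = 0)
    (hle : ∀ m : Fin (k + 1), 0 < m → m < n.succ → D.strandWeight (D.bdry 0, j 0) ≤ P m) :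
    D.opp (D.bdry 0) = D.bdry n := by
  set f : Fin k → D.Dart × WebState := fun i => (D.bdry i, j i) with hf
  have hk : 0 < k := Nat.pos_of_ne_zero (NeZero.ne k)
  -- No weight is zero, so the path cannot return to the origin with its first step.
  have hn0 : 0 < n.val := by
    rcases Nat.eq_zero_or_pos n.val with h | h
    · have : n = 0 := Fin.ext (by simpa using h)
      subst this
      have h1 := hP 0
      rw [hn, show (0 : Fin k).castSucc = 0 from rfl, hP0, strandWeight] at h1
      revert h1
      cases j 0 <;> cases D.color (D.bdry 0) <;> simp [weight, Prod.ext_iff]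
    · exact h
  -- Without its first step and translated back by it, the path is dominant from the origin: this is
  -- `hle`.
  have hpath : ∀ m : ℕ, ∀ hm : m + 1 ≤ n.val,
      D.DominantPath 0 (((List.ofFn f).take (m + 1)).tail)
        (P ⟨m + 1, by omega⟩ - D.strandWeight (f 0)) := by
    intro m
    induction m with
    | zero =>
      intro hm
      have h1 : P ⟨0 + 1, by omega⟩ = D.strandWeight (f 0) := by
        have := hP ⟨0, hk⟩
        rw [show (⟨0, hk⟩ : Fin k).castSucc = 0 from rfl, hP0, zero_add] at this
        exact this
      rw [h1, sub_self]
      have : ((List.ofFn f).take (0 + 1)).tail = [] := by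
        rw [← List.length_eq_zero_iff]; simp
      rw [this]; rfl
    | succ m ih =>
      intro hm
      have hlen : m + 1 < (List.ofFn f).length := by simp; omega
      rw [← List.take_concat_get' _ _ hlen, List.tail_append_of_ne_nil
        (by rw [← List.length_pos_iff]; simp; omega), dominantPath_append]
      refine ⟨_, ih (by omega), ?_⟩
      have h1 := hP ⟨m + 1, by omega⟩
      have h2 := hle ⟨m + 1 + 1, by omega⟩ (by simp [Fin.lt_def]) (by simp [Fin.lt_def]; omega)
      have h3 : P ⟨m + 1 + 1, by omega⟩ =
          P ⟨m + 1, by omega⟩ + D.strandWeight (f ⟨m + 1, by omega⟩) := h1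
      have h4 : P ⟨m + 1, by omega⟩ - D.strandWeight (f 0) +
          D.strandWeight ((List.ofFn f)[m + 1]) =
          P ⟨m + 1 + 1, by omega⟩ - D.strandWeight (f 0) := by
        rw [h3, List.getElem_ofFn]; abel
      exact ⟨by rw [h4]; exact sub_nonneg.2 h2, h4⟩
  have hend : P n.castSucc + D.strandWeight (f n) = 0 := by rw [← hn, hP]
  have hPn := hle n.castSucc (Fin.lt_def.2 hn0) Fin.castSucc_lt_succ
  -- The negative of the last weight dominates the first weight; among the six weights this forces
  -- equality.
  have hw : D.strandWeight (f n) = -D.strandWeight (f 0) := by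
    rw [eq_neg_of_add_eq_zero_left hend] at hPn
    revert h0 hPn
    simp only [strandWeight, hf]
    generalize j 0 = s, D.color (D.bdry 0) = c, j n = s', D.color (D.bdry n) = c'
    cases s <;> cases c <;> cases s' <;> cases c' <;> simp [weight, Prod.le_def]
  refine opp_eq_of_enclosing (u := f 0) (v := f n) hrun h0 hw
    ⟨((List.ofFn f).take n).tail, (List.ofFn f).drop (n + 1), ?_, ?_⟩
  · have hlen : n.val < (List.ofFn f).length := by simp
    have h1 : (List.ofFn f).take n = f 0 :: ((List.ofFn f).take n).tail := by
      have hne : (List.ofFn f).take n ≠ [] := by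
        rw [← List.length_pos_iff, List.length_take, List.length_ofFn]; omega
      conv_lhs => rw [← List.cons_head_tail hne]
      congr 1
      rw [List.head_eq_getElem]
      simp only [List.getElem_take, List.getElem_ofFn]
      rfl
    rw [← List.cons_append, ← h1]
    conv_lhs => rw [← List.take_append_drop n (List.ofFn f), List.drop_eq_getElem_cons hlen]
    simp
  · have := hpath (n.val - 1) (by omega)
    simp only [Nat.sub_add_cancel hn0] at this
    convert this
    have : (⟨n.val, by omega⟩ : Fin (k + 1)) = n.castSucc := rfl
    rw [this, eq_neg_of_add_eq_zero_left hend, hw]; simp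

end Web

/-! ### One move of the bullet, and the jeu de taquin step as a sequence of moves -/

namespace GOT

variable {k n : ℕ}

theorem bottomRow_eq {p : Fin n → ℤ} {r s : Fin n} (h : p s = p r)
    (h' : ∀ t, s < t → p t ≠ p r) : bottomRow p r = s := by
  refine le_antisymm (Finset.max'_le _ _ _ fun t ht => ?_) (Finset.le_max' _ _ (by simpa using h))
  exact not_lt.1 fun hlt => h' t hlt (by simpa using ht)

theorem topRow_eq {p : Fin n → ℤ} {r s : Fin n} (h : p s = p r)
    (h' : ∀ t, t < s → p t ≠ p r) : topRow p r = s := by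
  refine le_antisymm (Finset.min'_le _ _ (by simpa using h)) (Finset.le_min' _ _ _ fun t ht => ?_)
  exact not_lt.1 fun hlt => h' t hlt (by simpa using ht)

theorem part_succ_row (T : GOT k n) (i : Fin k) :
    T.part i.succ (T.row i) =
      T.part i.castSucc (T.row i) + if T.primed i then (-1 : ℤ) else 1 := by
  rw [T.part_succ]; simp

theorem part_succ_of_ne (T : GOT k n) {i : Fin k} {r : Fin n} (h : r ≠ T.row i) :
    T.part i.succ r = T.part i.castSucc r := by
  rw [T.part_succ]; simp [h]

/-- The row `r` differs from that of the entry `i` if and only if `p` holds, and then it is one row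
higher if `i` is unprimed and one row lower if `i` is primed. -/
def MovesIff (T : GOT k n) (i : Fin k) (r : Fin n) (p : Prop) : Prop :=
  (r ≠ T.row i ↔ p) ∧ (r ≠ T.row i →
    (T.primed i = false → r.val + 1 = (T.row i).val) ∧
    (T.primed i = true → r.val = (T.row i).val + 1))

variable [NeZero k]

theorem slide_entry_of_ne (T : GOT k n) {i j : Fin k} (h : j ≠ i) (F : Filling k n) :
    (T.slide i F).entry j = F.entry j := by
  unfold slide
  dsimp only
  split_ifs <;> simp [h]

/-- The index `m` counts the entries already treated, the deleted first one included; hence the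
start at `(0 : Fin k).succ`. -/
theorem slideAll_induction (T : GOT k n) {P : Fin (k + 1) → Filling k n → Prop}
    (h₁ : P (0 : Fin k).succ T.startFilling)
    (hs : ∀ i : Fin k, i ≠ 0 → ∀ F, P i.castSucc F → P i.succ (T.slide i F)) :
    P (Fin.last k) T.slideAll := by
  have hk : 0 < k := Nat.pos_of_ne_zero (NeZero.ne k)
  have key : ∀ m : ℕ, ∀ hm : m + 1 < k + 1, P ⟨m + 1, hm⟩
      (((List.finRange k).tail.take m).foldl (fun F i => T.slide i F) T.startFilling) := by
    intro m
    induction m with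
    | zero => intro _; exact h₁
    | succ m ih =>
      intro hm
      have hlen : m < (List.finRange k).tail.length := by simp; omega
      rw [← List.take_concat_get' _ _ hlen, List.foldl_append]
      simp only [List.foldl_cons, List.foldl_nil, List.getElem_tail, List.getElem_finRange]
      exact hs ⟨m + 1, by omega⟩ (by simp [Fin.ext_iff]) _ (ih (by omega))
  have := key (k - 1) (by omega)
  rw [List.take_of_length_le (by simp)] at this
  have hlast : (⟨k - 1 + 1, by omega⟩ : Fin (k + 1)) = Fin.last k := Fin.ext (by simp; omega)
  rwa [hlast] at this

/-- One move of an unprimed bullet that sits at the end of a row, which is longer than all lower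
rows: the bullet goes to row `s`. -/
theorem slide_unprimed (T : GOT k n) (h0 : T.primed 0 = false) {i : Fin k} {F : Filling k n}
    {r s : Fin n} (hentry : F.entry i = T.box i) (hb : F.bullet = (r, T.part i.castSucc r))
    (hr : ∀ t, r < t → T.part i.castSucc t < T.part i.castSucc r)
    (hrs : r ≤ s) (hsr : s.val ≤ r.val + 1) (heq : T.part i.succ s = T.part i.succ r)
    (hs : ∀ t, s < t → T.part i.succ t < T.part i.succ s) :
    (T.slide i F).bullet = (s, T.part i.succ s) ∧
      T.MovesIff i ((T.slide i F).entry i).1 (s ≠ r) := by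
  have hrow := T.part_succ_row i
  unfold MovesIff
  by_cases hp : T.primed i = true
  · rw [hp, if_pos rfl] at hrow
    by_cases hri : T.row i = r
    · subst hri
      have hslide : T.slide i F = ⟨Function.update F.entry i (s, T.part i.succ s), (s, T.part i.succ s)⟩ := by
        simp [slide, h0, hp, hentry, hb, box,
          bottomRow_eq heq fun t ht => ((hs t ht).trans_eq heq).ne, heq, hrow, sub_eq_add_neg]
      rw [hslide]
      refine ⟨rfl, by simp, fun h => ⟨by simp [hp], fun _ => ?_⟩⟩
      simp only [Function.update_self] at h ⊢
      have := Fin.val_ne_of_ne h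
      rw [Fin.le_def] at hrs
      omega
    -- Removing a box from another row cannot make a lower row catch up with row `r`, so no tie
    -- arises.
    · have hsr' : s = r := by
        by_contra hne
        have h1 := hr s (lt_of_le_of_ne hrs (Ne.symm hne))
        rw [T.part_succ_of_ne (Ne.symm hri)] at heq
        by_cases hsi : s = T.row i
        · rw [hsi] at heq h1; omega
        · rw [T.part_succ_of_ne hsi] at heq; omega
      subst hsr'
      have hslide : T.slide i F = F := by simp [slide, h0, hp, hentry, hb, box, hri]
      rw [hslide, hb, hentry, T.part_succ_of_ne (Ne.symm hri)]
      simp [box]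
  · rw [Bool.not_eq_true] at hp
    simp only [hp, Bool.false_eq_true, if_false] at hrow
    by_cases hri : T.row i = r
    · subst hri
      -- Lengthening the bullet's own row creates no tie below it; the swap is then horizontal.
      have hsr' : s = T.row i := by
        by_contra hne
        have h1 := hr s (lt_of_le_of_ne hrs (Ne.symm hne))
        rw [T.part_succ_of_ne hne] at heq
        omega
      subst hsr'
      have hslide : T.slide i F = ⟨Function.update F.entry i F.bullet, F.entry i⟩ := by
        simp [slide, h0, hp, hentry, hb, box, hrow]
      rw [hslide, hentry, hb]
      simp [box, hp]
    · rw [T.part_succ_of_ne (Ne.symm hri)] at heq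
      by_cases hsr' : s = r
      · subst hsr'
        have hslide : T.slide i F = F := by
          -- A new box directly below the bullet would make the two rows equal, against `hs`.
          have : ¬ ((T.row i).val = s.val + 1 ∧
              T.part i.succ (T.row i) = T.part i.castSucc s) := by
            rintro ⟨h1, h2⟩
            have := hs (T.row i) (Fin.lt_def.2 (by omega))
            omega
          simp [slide, h0, hp, hentry, hb, box, hri, this]
        rw [hslide, hb, hentry, T.part_succ_of_ne (Ne.symm hri)]
        simp [box]
      · have h1 := hr s (lt_of_le_of_ne hrs (Ne.symm hsr'))
        -- The tie is new, so the step must have lengthened row `s`; its new box is directly below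
        -- the bullet.
        have hsi : s = T.row i := by
          by_contra hsi
          rw [T.part_succ_of_ne hsi] at heq; omega
        subst hsi
        have hval : (T.row i).val = r.val + 1 := by
          have := Fin.val_ne_of_ne hsr'
          rw [Fin.le_def] at hrs; omega
        have hslide : T.slide i F = ⟨Function.update F.entry i F.bullet, F.entry i⟩ := by
          simp [slide, h0, hp, hentry, hb, box, heq, hval]
        rw [hslide, hentry, hb]
        simp [box, hp, hval, hri, Ne.symm hri]

/-- One move of a primed bullet that sits just behind the end of a row, which is shorter than all
higher rows: the bullet goes to row `s`. -/
theorem slide_primed (T : GOT k n) (h0 : T.primed 0 = true) {i : Fin k} {F : Filling k n}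
    {r s : Fin n} (hentry : F.entry i = T.box i) (hb : F.bullet = (r, T.part i.castSucc r + 1))
    (hr : ∀ t, t < r → T.part i.castSucc r < T.part i.castSucc t)
    (hrs : s ≤ r) (hsr : r.val ≤ s.val + 1) (heq : T.part i.succ s = T.part i.succ r)
    (hs : ∀ t, t < s → T.part i.succ s < T.part i.succ t) :
    (T.slide i F).bullet = (s, T.part i.succ s + 1) ∧
      T.MovesIff i ((T.slide i F).entry i).1 (s ≠ r) := by
  have hrow := T.part_succ_row i
  unfold MovesIff
  by_cases hp : T.primed i = true
  · rw [hp, if_pos rfl] at hrow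
    by_cases hri : T.row i = r
    · subst hri
      have hsr' : s = T.row i := by
        by_contra hne
        have h1 := hr s (lt_of_le_of_ne hrs hne)
        rw [T.part_succ_of_ne hne] at heq
        omega
      subst hsr'
      have hslide : T.slide i F = ⟨Function.update F.entry i F.bullet, F.entry i⟩ := by
        simp [slide, h0, hp, hentry, hb, box]
      rw [hslide, hentry, hb]
      simp [box, hp, hrow]
    · rw [T.part_succ_of_ne (Ne.symm hri)] at heq
      by_cases hsr' : s = r
      · subst hsr'
        have hslide : T.slide i F = F := by
          have : ¬ ((T.row i).val + 1 = s.val ∧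
              T.part i.castSucc (T.row i) = T.part i.castSucc s + 1) := by
            rintro ⟨h1, h2⟩
            have := hs (T.row i) (Fin.lt_def.2 (by omega))
            omega
          simp [slide, h0, hp, hentry, hb, box, hri, this]
        rw [hslide, hb, hentry, T.part_succ_of_ne (Ne.symm hri)]
        simp [box]
      · have h1 := hr s (lt_of_le_of_ne hrs hsr')
        have hsi : s = T.row i := by
          by_contra hsi
          rw [T.part_succ_of_ne hsi] at heq; omega
        subst hsi
        have hval : (T.row i).val + 1 = r.val := by
          have := Fin.val_ne_of_ne hsr'
          rw [Fin.le_def] at hrs; omega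
        -- The removal makes the two rows equal, so the removed box was one column past the end of
        -- row `r`, directly above the bullet.
        have hcol : T.part i.castSucc (T.row i) = T.part i.castSucc r + 1 := by omega
        have hslide : T.slide i F = ⟨Function.update F.entry i F.bullet, F.entry i⟩ := by
          simp [slide, h0, hp, hentry, hb, box, hcol, hval]
        rw [hslide, hentry, hb]
        simp [box, hp, hval, hri, Ne.symm hri, hcol, heq]
  · rw [Bool.not_eq_true] at hp
    simp only [hp, Bool.false_eq_true, if_false] at hrow
    by_cases hri : T.row i = r
    · subst hri
      have hslide : T.slide i F = ⟨Function.update F.entry i (s, T.part i.succ s + 1), (s, T.part i.succ s + 1)⟩ := by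
        simp [slide, h0, hp, hentry, hb, box,
          topRow_eq heq fun t ht => (heq.symm.trans_lt (hs t ht)).ne', heq, hrow]
      rw [hslide]
      refine ⟨rfl, by simp, fun h => ⟨fun _ => ?_, by simp [hp]⟩⟩
      simp only [Function.update_self] at h ⊢
      have := Fin.val_ne_of_ne h
      rw [Fin.le_def] at hrs
      omega
    · have hsr' : s = r := by
        by_contra hne
        have h1 := hr s (lt_of_le_of_ne hrs hne)
        rw [T.part_succ_of_ne (Ne.symm hri)] at heq
        by_cases hsi : s = T.row i
        · rw [hsi] at heq h1; omega
        · rw [T.part_succ_of_ne hsi] at heq; omega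
      subst hsr'
      have hslide : T.slide i F = F := by simp [slide, h0, hp, hentry, hb, box, hri]
      rw [hslide, hb, hentry, T.part_succ_of_ne (Ne.symm hri)]
      simp [box]

/-- If `ρ i` and `c i` are the row and column of the bullet before the move of the entry `i`, as
certified move by move, then the entries that change row are those at which `ρ` changes. -/
theorem movesIff_newRow (T : GOT k n) (ρ : Fin (k + 1) → Fin n) (c : Fin (k + 1) → ℤ)
    (hstart : T.box 0 = (ρ (0 : Fin k).succ, c (0 : Fin k).succ))
    (hstep : ∀ i : Fin k, i ≠ 0 → ∀ F : Filling k n, F.entry i = T.box i →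
      F.bullet = (ρ i.castSucc, c i.castSucc) →
      (T.slide i F).bullet = (ρ i.succ, c i.succ) ∧
        T.MovesIff i ((T.slide i F).entry i).1 (ρ i.succ ≠ ρ i.castSucc))
    {i : Fin k} (hi : i ≠ 0) : T.MovesIff i (T.newRow i) (ρ i.succ ≠ ρ i.castSucc) := by
  -- A move touches only its own entry, so entries still to come are in their original boxes and
  -- treated entries keep their rows.
  have := T.slideAll_induction (P := fun m F => F.bullet = (ρ m, c m) ∧
      (∀ j : Fin k, m ≤ j.castSucc → F.entry j = T.box j) ∧
      ∀ j : Fin k, j ≠ 0 → j.castSucc < m →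
        T.MovesIff j (F.entry j).1 (ρ j.succ ≠ ρ j.castSucc))
    ⟨hstart, fun _ _ => rfl, fun j hj hlt => absurd (Fin.ext ?_) hj⟩ ?_
  · exact this.2.2 i hi (Fin.castSucc_lt_last i)
  · have h : j.val < (0 : Fin k).val + 1 := hlt
    rw [Fin.val_zero] at h ⊢
    omega
  · rintro i hi F ⟨hb, hge, hlt⟩
    obtain ⟨h1, h2⟩ := hstep i hi F (hge i le_rfl) hb
    refine ⟨h1, fun j hj => ?_, fun j hj0 hj => ?_⟩
    · have hij : i < j := Fin.succ_le_castSucc_iff.1 hj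
      rw [T.slide_entry_of_ne hij.ne']
      exact hge j (by simpa using hij.le)
    · by_cases hji : j = i
      · exact hji ▸ h2
      · rw [T.slide_entry_of_ne hji]
        refine hlt j hj0 ?_
        have := Fin.val_ne_of_ne hji
        simp only [Fin.lt_def, Fin.val_castSucc, Fin.val_succ] at hj ⊢
        omega

end GOT

/-! ### The tableau as a path in the weight lattice, and the row of the bullet -/

namespace GOT

variable {k : ℕ}

/-- The point of the weight lattice of `sl(3)` given by a partition, in the basis of fundamental
weights. -/
def point (T : GOT k 3) (m : Fin (k + 1)) : ℤ × ℤ :=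
  (T.part m 0 - T.part m 1, T.part m 1 - T.part m 2)

theorem point_zero (T : GOT k 3) : T.point 0 = 0 := by
  simp [point, T.part_zero]

theorem point_nonneg (T : GOT k 3) (m : Fin (k + 1)) : 0 ≤ T.point m :=
  Prod.le_def.2 ⟨sub_nonneg.2 (T.part_antitone m (by decide)),
    sub_nonneg.2 (T.part_antitone m (by decide))⟩

theorem point_succ (T : GOT k 3) {i : Fin k} {j : WebState} {c : WebColor}
    (hrow : T.row i = j.row) (hprimed : T.primed i = true ↔ c = .white) :
    T.point i.succ = T.point i.castSucc + Web.weight j c := by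
  have hp : T.primed i = decide (c = .white) := by
    rw [Bool.eq_iff_iff, hprimed, decide_eq_true_iff]
  simp only [point, T.part_succ, hrow, hp]
  cases j <;> cases c <;> simp [WebState.row, Web.weight, Prod.ext_iff] <;> omega

theorem point_last (T : GOT k 3) {D : Web k} {j : Fin k → WebState}
    (hj : D.IsStateString j)
    (hstep : ∀ i : Fin k, T.point i.succ = T.point i.castSucc + Web.weight (j i) (D.signature i)) :
    T.point (Fin.last k) = 0 := by
  have h : ∀ m : Fin (k + 1), T.point m =
      ∑ i : Fin k with i.val < m.val, Web.weight (j i) (D.signature i) := by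
    intro m
    induction m using Fin.induction with
    | zero => simp [T.point_zero]
    | succ i ih =>
      rw [hstep, ih]
      have : (Finset.univ.filter fun l : Fin k => l.val < i.succ.val) =
          insert i (Finset.univ.filter fun l : Fin k => l.val < i.castSucc.val) := by
        ext l
        simp [Fin.ext_iff]
        omega
      rw [this, Finset.sum_insert (by simp), add_comm]
  rw [h, ← hj.1.2]
  congr 1
  ext i
  simp

theorem exists_isLeast_of_mem {S : Set (Fin (k + 1))} {x : Fin (k + 1)} (hx : x ∈ S) :
    ∃ a, IsLeast S a := by
  have hS : S.Nonempty := ⟨x, hx⟩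
  exact ⟨wellFounded_lt.min S hS, wellFounded_lt.min_mem S hS,
    fun y hy => not_lt.1 (wellFounded_lt.not_lt_min S hy)⟩

/-- The path ends at the origin, where all walls meet, so the last index is a candidate for both
minima; for the second one this needs `a` to be strictly earlier, which `hne` provides. -/
theorem exists_firstEqualities (T : GOT k 3) [NeZero k] {p q : Fin 2}
    (hlast : T.point (Fin.last k) = 0)
    (hne : ∀ a, IsLeast {i | 0 < i ∧ T.part i p.castSucc = T.part i p.succ} a → T.point a ≠ 0) :
    ∃ a b, T.FirstEqualities p q a b := by
  have heq : ∀ p : Fin 2, T.part (Fin.last k) p.castSucc = T.part (Fin.last k) p.succ := by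
    intro p
    simp only [point, Prod.ext_iff, Prod.fst_zero, Prod.snd_zero, sub_eq_zero] at hlast
    fin_cases p
    exacts [hlast.1, hlast.2]
  obtain ⟨a, ha⟩ := exists_isLeast_of_mem
    (S := {i | 0 < i ∧ T.part i p.castSucc = T.part i p.succ}) (x := Fin.last k)
    ⟨Fin.lt_def.2 (Nat.pos_of_ne_zero (NeZero.ne k)), heq p⟩
  have hak : a < Fin.last k :=
    lt_of_le_of_ne (Fin.le_last a) fun h => hne a ha (h ▸ hlast)
  obtain ⟨b, hb⟩ := exists_isLeast_of_mem
    (S := {i | a < i ∧ T.part i q.castSucc = T.part i q.succ}) (x := Fin.last k) ⟨hak, heq q⟩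
  exact ⟨a, b, ha, hb⟩

/-- The function with value `r₀` before `a`, then `r₁` before `b`, then `r₂`. -/
def stage (a b : Fin (k + 1)) (r₀ r₁ r₂ : Fin 3) (m : Fin (k + 1)) : Fin 3 :=
  if m < a then r₀ else if m < b then r₁ else r₂

theorem stage_step {a b : Fin (k + 1)} (hab : a < b) (r₀ r₁ r₂ : Fin 3) (i : Fin k) :
    (i.succ = a ∧ stage a b r₀ r₁ r₂ i.castSucc = r₀ ∧ stage a b r₀ r₁ r₂ a = r₁) ∨
    (i.succ = b ∧ stage a b r₀ r₁ r₂ i.castSucc = r₁ ∧ stage a b r₀ r₁ r₂ b = r₂) ∨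
    (i.succ ≠ a ∧ i.succ ≠ b ∧
      stage a b r₀ r₁ r₂ i.succ = stage a b r₀ r₁ r₂ i.castSucc) := by
  simp only [stage, Fin.lt_def, ne_eq, Fin.ext_iff, Fin.val_succ, Fin.val_castSucc] at hab ⊢
  grind

variable [NeZero k]

/-- The bullet's row is `stage a b 0 1 2`, and its column is the size of that row. Minimality of `a`
and `b` makes the row strictly longer than the lower ones at all times, as a single move requires.
-/
theorem movesIff_of_unprimed (T : GOT k 3) (h0 : T.primed 0 = false) (hrow : T.row 0 = 0)
    {a b : Fin (k + 1)} (h : T.FirstEqualities 0 1 a b) (hne : T.point a ≠ 0) {i : Fin k}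
    (hi : i ≠ 0) : T.MovesIff i (T.newRow i) (i.succ = a ∨ i.succ = b) := by
  obtain ⟨⟨⟨ha0, haeq⟩, ha⟩, ⟨⟨hab, hbeq⟩, hb⟩⟩ := h
  have haeq' : T.part a 0 = T.part a 1 := haeq
  have hbeq' : T.part b 1 = T.part b 2 := hbeq
  have hmono (m : Fin (k + 1)) : T.part m 1 ≤ T.part m 0 ∧ T.part m 2 ≤ T.part m 1 :=
    ⟨T.part_antitone m (by decide), T.part_antitone m (by decide)⟩
  have hlta (m : Fin (k + 1)) (h0 : 0 < m) (hm : m < a) : T.part m 1 < T.part m 0 :=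
    lt_of_le_of_ne (hmono m).1 fun h => hm.not_ge (ha ⟨h0, h.symm⟩)
  have hltb (m : Fin (k + 1)) (h0 : a ≤ m) (hm : m < b) : T.part m 2 < T.part m 1 := by
    refine lt_of_le_of_ne (hmono m).2 fun h => ?_
    rcases h0.eq_or_lt with rfl | h0
    -- Minimality of `b` says nothing at time `a` itself; there a second tie would put the path at
    -- the origin.
    · exact hne (by simp [point, haeq', h])
    · exact hm.not_ge (hb ⟨h0, h.symm⟩)
  -- The first box makes row `0` longer than row `1`, so the bullet starts in stage `0`.
  have ha1 : (0 : Fin k).succ < a := by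
    refine lt_of_le_of_ne (Fin.castSucc_lt_iff_succ_le.1 ha0) ?_
    rintro rfl
    have h1 := T.part_succ 0
    rw [show (0 : Fin k).castSucc = 0 from rfl, T.part_zero, hrow, h0] at h1
    rw [h1] at haeq'
    simp at haeq'
  have hcorner : ∀ m, 0 < m → ∀ t, stage a b 0 1 2 m < t →
      T.part m t < T.part m (stage a b 0 1 2 m) := by
    intro m hm t ht
    have := hmono m
    have := hlta m hm
    have := hltb m
    simp only [stage] at ht ⊢
    split_ifs at ht ⊢ with h1 h2 <;> fin_cases t <;> simp at ht ⊢ <;> grind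
  have key := T.movesIff_newRow (stage a b 0 1 2) (fun m => T.part m (stage a b 0 1 2 m)) ?_ ?_ hi
  · convert key using 1
    rcases stage_step hab 0 1 2 i with ⟨h, h1, h2⟩ | ⟨h, h1, h2⟩ | ⟨h, h', h1⟩ <;> simp [*]
  · have h1 : stage a b 0 1 2 (0 : Fin k).succ = 0 := if_pos ha1
    rw [h1]
    simp [box, h0, hrow]
  · intro i hi F hentry hbullet
    have hpos : 0 < i.castSucc := Fin.castSucc_pos_iff.2 (Fin.pos_iff_ne_zero.2 hi)
    refine T.slide_unprimed h0 hentry hbullet (hcorner _ hpos) ?_ ?_ ?_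
      (hcorner _ (Fin.succ_pos i)) <;>
    rcases stage_step hab 0 1 2 i with ⟨h, h1, h2⟩ | ⟨h, h1, h2⟩ | ⟨h, h', h1⟩ <;> simp [*]

/-- The mirror image: the rows are traversed upwards, and the `+ 1` in the column places the bullet
just past the end of its row, where the first step removed a box. -/
theorem movesIff_of_primed (T : GOT k 3) (h0 : T.primed 0 = true) (hrow : T.row 0 = 2)
    {a b : Fin (k + 1)} (h : T.FirstEqualities 1 0 a b) (hne : T.point a ≠ 0) {i : Fin k}
    (hi : i ≠ 0) : T.MovesIff i (T.newRow i) (i.succ = a ∨ i.succ = b) := by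
  obtain ⟨⟨⟨ha0, haeq⟩, ha⟩, ⟨⟨hab, hbeq⟩, hb⟩⟩ := h
  have haeq' : T.part a 1 = T.part a 2 := haeq
  have hbeq' : T.part b 0 = T.part b 1 := hbeq
  have hmono (m : Fin (k + 1)) : T.part m 1 ≤ T.part m 0 ∧ T.part m 2 ≤ T.part m 1 :=
    ⟨T.part_antitone m (by decide), T.part_antitone m (by decide)⟩
  have hlta (m : Fin (k + 1)) (h0 : 0 < m) (hm : m < a) : T.part m 2 < T.part m 1 :=
    lt_of_le_of_ne (hmono m).2 fun h => hm.not_ge (ha ⟨h0, h.symm⟩)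
  have hltb (m : Fin (k + 1)) (h0 : a ≤ m) (hm : m < b) : T.part m 1 < T.part m 0 := by
    refine lt_of_le_of_ne (hmono m).1 fun h => ?_
    rcases h0.eq_or_lt with rfl | h0
    · exact hne (by simp [point, haeq', ← h])
    · exact hm.not_ge (hb ⟨h0, h.symm⟩)
  have ha1 : (0 : Fin k).succ < a := by
    refine lt_of_le_of_ne (Fin.castSucc_lt_iff_succ_le.1 ha0) ?_
    rintro rfl
    have h1 := T.part_succ 0
    rw [show (0 : Fin k).castSucc = 0 from rfl, T.part_zero, hrow, h0] at h1
    rw [h1] at haeq'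
    simp at haeq'
  have hcorner : ∀ m, 0 < m → ∀ t, t < stage a b 2 1 0 m →
      T.part m (stage a b 2 1 0 m) < T.part m t := by
    intro m hm t ht
    have := hmono m
    have := hlta m hm
    have := hltb m
    simp only [stage] at ht ⊢
    split_ifs at ht ⊢ with h1 h2 <;> fin_cases t <;> simp at ht ⊢ <;> grind
  have key := T.movesIff_newRow (stage a b 2 1 0)
    (fun m => T.part m (stage a b 2 1 0 m) + 1) ?_ ?_ hi
  · convert key using 1
    rcases stage_step hab 2 1 0 i with ⟨h, h1, h2⟩ | ⟨h, h1, h2⟩ | ⟨h, h', h1⟩ <;> simp [*]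
  · have h1 : stage a b 2 1 0 (0 : Fin k).succ = 2 := if_pos ha1
    have h2 := T.part_succ_row 0
    rw [hrow, h0] at h2
    rw [h1, h2]
    simp [box, h0, hrow]
  · intro i hi F hentry hbullet
    have hpos : 0 < i.castSucc := Fin.castSucc_pos_iff.2 (Fin.pos_iff_ne_zero.2 hi)
    refine T.slide_primed h0 hentry hbullet (hcorner _ hpos) ?_ ?_ ?_
      (hcorner _ (Fin.succ_pos i)) <;>
    rcases stage_step hab 2 1 0 i with ⟨h, h1, h2⟩ | ⟨h, h1, h2⟩ | ⟨h, h', h1⟩ <;> simp [*]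

/-- Without an identity component, the lattice path of a web is not at the origin when it first
leaves the translate of the chamber by its first step. -/
theorem point_ne_zero (T : GOT k 3) {D : Web k} (hD : ¬ D.ContainsIdentity) {j : Fin k → WebState}
    (hj : D.IsStateString j)
    (hstep : ∀ i : Fin k, T.point i.succ = T.point i.castSucc + Web.weight (j i) (D.signature i))
    {a : Fin (k + 1)} (ha : 0 < a)
    (hle : ∀ m, 0 < m → m < a → T.point (0 : Fin k).succ ≤ T.point m) : T.point a ≠ 0 := by
  intro h
  obtain ⟨n, rfl⟩ := Fin.exists_succ_eq.2 ha.ne'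
  have h1 : T.point (0 : Fin k).succ = D.strandWeight (D.bdry 0, j 0) := by
    rw [hstep, show (0 : Fin k).castSucc = 0 from rfl, T.point_zero, zero_add]; rfl
  rw [h1] at hle
  exact hD ⟨0, n, Web.opp_bdry_zero_of_path hj.2 T.point T.point_zero hstep
    (h1 ▸ T.point_nonneg _) h hle⟩

end GOT

/-! ### The two colours of the leftmost vertex -/

theorem mainTheorem4 (k : ℕ) [NeZero k] (D : Web k) (hD : ¬ D.ContainsIdentity)
    (T : GOT k 3) (hT : T.ComesFrom D) :
    (D.color (D.bdry 0) = .black →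
      ∃ a b, T.FirstEqualities 0 1 a b ∧
        ∀ i : Fin k, i ≠ 0 → (T.ChangesRow i ↔ i.succ = a ∨ i.succ = b)) ∧
    (D.color (D.bdry 0) = .white →
      ∃ a b, T.FirstEqualities 1 0 a b ∧
        ∀ i : Fin k, i ≠ 0 → (T.ChangesRow i ↔ i.succ = a ∨ i.succ = b)) ∧
    (∀ i : Fin k, i ≠ 0 → T.ChangesRow i →
      (T.primed i = false → (T.newRow i).val + 1 = (T.row i).val) ∧
      (T.primed i = true → (T.newRow i).val = (T.row i).val + 1)) := by
  obtain ⟨j, hj, hrow⟩ := hT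
  have hstep : ∀ i : Fin k,
      T.point i.succ = T.point i.castSucc + Web.weight (j i) (D.signature i) :=
    fun i => T.point_succ (hrow i).1 (hrow i).2
  have hlast := T.point_last hj hstep
  have h1 : T.point (0 : Fin k).succ = Web.weight (j 0) (D.signature 0) := by
    rw [hstep, show (0 : Fin k).castSucc = 0 from rfl, T.point_zero, zero_add]
  have h1nonneg := h1 ▸ T.point_nonneg (0 : Fin k).succ
  have hblack : D.color (D.bdry 0) = .black →
      ∃ a b, T.FirstEqualities 0 1 a b ∧
        ∀ i : Fin k, i ≠ 0 → T.MovesIff i (T.newRow i) (i.succ = a ∨ i.succ = b) := by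
    intro hc
    have hs : D.signature 0 = .black := hc
    rw [hs] at h1 h1nonneg
    -- The first step leaves the origin within the chamber, which leaves one state for each colour.
    have hj0 : j 0 = .one := by
      revert h1nonneg; cases j 0 <;> simp [Web.weight, Prod.le_def]
    have hne : ∀ a, IsLeast {i | 0 < i ∧ T.part i (0 : Fin 2).castSucc = T.part i (0 : Fin 2).succ}
        a → T.point a ≠ 0 := by
      refine fun a ha => T.point_ne_zero hD hj hstep ha.1.1 fun m hm hma => ?_
      rw [h1, hj0]
      have hm1 := T.point_nonneg m
      refine Prod.le_def.2 ⟨?_, hm1.2⟩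
      -- Before `a` the first coordinate is a positive integer, hence at least the `1` of the first
      -- step.
      exact lt_of_le_of_ne hm1.1 fun h => hma.not_ge (ha.2 ⟨hm, sub_eq_zero.1 h.symm⟩)
    obtain ⟨a, b, hab⟩ := T.exists_firstEqualities (q := 1) hlast hne
    refine ⟨a, b, hab, fun i hi => T.movesIff_of_unprimed ?_ ?_ hab (hne a hab.1) hi⟩
    · rw [Bool.eq_false_iff, ne_eq, (hrow 0).2, hs]; simp
    · rw [(hrow 0).1, hj0]; rfl
  have hwhite : D.color (D.bdry 0) = .white →
      ∃ a b, T.FirstEqualities 1 0 a b ∧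
        ∀ i : Fin k, i ≠ 0 → T.MovesIff i (T.newRow i) (i.succ = a ∨ i.succ = b) := by
    intro hc
    have hs : D.signature 0 = .white := hc
    rw [hs] at h1 h1nonneg
    have hj0 : j 0 = .negOne := by
      revert h1nonneg; cases j 0 <;> simp [Web.weight, Prod.le_def]
    have hne : ∀ a, IsLeast {i | 0 < i ∧ T.part i (1 : Fin 2).castSucc = T.part i (1 : Fin 2).succ}
        a → T.point a ≠ 0 := by
      refine fun a ha => T.point_ne_zero hD hj hstep ha.1.1 fun m hm hma => ?_
      rw [h1, hj0]
      have hm1 := T.point_nonneg m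
      refine Prod.le_def.2 ⟨hm1.1, ?_⟩
      exact lt_of_le_of_ne hm1.2 fun h => hma.not_ge (ha.2 ⟨hm, sub_eq_zero.1 h.symm⟩)
    obtain ⟨a, b, hab⟩ := T.exists_firstEqualities (q := 0) hlast hne
    refine ⟨a, b, hab, fun i hi => T.movesIff_of_primed ?_ ?_ hab (hne a hab.1) hi⟩
    · exact (hrow 0).2.2 hs
    · rw [(hrow 0).1, hj0]; rfl
  refine ⟨fun hc => ?_, fun hc => ?_, fun i hi hch => ?_⟩
  · obtain ⟨a, b, hab, h⟩ := hblack hc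
    exact ⟨a, b, hab, fun i hi => (h i hi).1⟩
  · obtain ⟨a, b, hab, h⟩ := hwhite hc
    exact ⟨a, b, hab, fun i hi => (h i hi).1⟩
  · cases hc : D.color (D.bdry 0) with
    | black =>
      obtain ⟨a, b, -, h⟩ := hblack hc
      exact (h i hi).2 hch
    | white =>
      obtain ⟨a, b, -, h⟩ := hwhite hc
      exact (h i hi).2 hch
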